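/- Let $A$ and $B$ be finite alphabets, let $X\subseteq A^{\mathbb Z}$ be a non-empty shift of finite type (a set of bi-infinite sequences given by finitely many forbidden words), and let $Y\subseteq B^{\mathbb Z}$ be an irreducible sofic shift; that is, $Y$ is the set of label sequences of bi-infinite paths in some finite labeled directed graph, and for all words $u,v$ occurring in points of $Y$ there is a word $w$ such that $uwv$ occurs in a point of $Y$. Let $\phi:X\to Y$ be a code, i.e. there are integers $-m\le n$ and a map $\Phi$ on the words of length $m+n+1$ occurring in $X$ with $\phi(x)_i=\Phi(x_{i-m}\cdots x_{i+n})$ for all $x\in X$ and $i\in\mathbb Z$. Suppose that 1. $\phi$ is finite-to-one: $\phi^{-1}(y)$ is finite for every $y\in Y$; 2. $\phi$ is semi-open: for each $l\in\mathbb N$ there is $k\in\mathbb N$ such that for every $x\in X$ there is $y\in Y$ with $$\{y'\in Y:\ y'_{[-k,k]}=y_{[-k,k]}\}\subseteq \phi\big(\{x'\in X:\ x'_{[-l,l]}=x_{[-l,l]}\}\big).$$ Then $\phi$ is constant-to-one almost everywhere: there is a positive integer $d$ such that every doubly transitive point $y\in Y$ has exactly $d$ preimages under $\phi$. Here $y\in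 Y$ is doubly transitive if every word occurring in a point of $Y$ occurs in $y$ infinitely often to the left and infinitely often to the right. -/

import Mathlib

open SymbolicDynamics.FullShift

namespace ShiftCode

/-! Shift spaces over a finite discrete alphabet `A` are Mathlib's `Subshift A ℤ`: closed subsets of
`ℤ → A` that are invariant under all translations (so `σ(X) = X` for the shift `σ`). -/

/-- The block `x_{[i, i+n-1]}` of length `n`. -/
def block {A : Type*} (x : ℤ → A) (i : ℤ) (n : ℕ) : List A :=
  List.ofFn fun k : Fin n => x (i + (k : ℤ))

/-- The word `w` occurs in `x` at the position `i`. -/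
def OccursAt {A : Type*} (w : List A) (x : ℤ → A) (i : ℤ) : Prop :=
  block x i w.length = w

section Subshifts

variable {A : Type*} [TopologicalSpace A]

/-- The language `ℬ(X)`: all words that occur in points of `X`. -/
def language (X : Subshift A ℤ) : Set (List A) :=
  {w | ∃ x ∈ X.carrier, ∃ i : ℤ, OccursAt w x i}

/-- `X` is a shift of finite type: it is given by a finite list of forbidden words. -/
def IsSFT (X : Subshift A ℤ) : Prop :=
  ∃ F : Finset (List A), X.carrier = {x | ∀ w ∈ F, ∀ i : ℤ, ¬ OccursAt w x i}

/-- `X` is irreducible: any two words `u, v` of `X` are joined by a word `w` so that `uwv` is a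
word of `X`. -/
def IsIrreducible (X : Subshift A ℤ) : Prop :=
  ∀ u ∈ language X, ∀ v ∈ language X, ∃ w : List A, u ++ w ++ v ∈ language X

/-- `x` is doubly transitive in `X`: it is a point of `X`, and every block of `X` appears in `x`
infinitely often to the left and to the right. -/
def IsDoublyTransitive (X : Subshift A ℤ) (x : ℤ → A) : Prop :=
  x ∈ X.carrier ∧ ∀ w ∈ language X, ∀ N : ℕ,
    (∃ i : ℤ, i ≤ -(N : ℤ) ∧ OccursAt w x i) ∧ (∃ i : ℤ, (N : ℤ) ≤ i ∧ OccursAt w x i)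

end Subshifts

/-- A directed graph with vertex set `V` and edge set `E` whose edges are labeled by `A`. -/
structure LabeledGraph (V E A : Type*) where
  /-- initial vertex of an edge -/
  init : E → V
  /-- terminal vertex of an edge -/
  term : E → V
  /-- label of an edge -/
  label : E → A

/-- The edge shift of the graph: all bi-infinite paths. -/
def LabeledGraph.edgeShift {V E A : Type*} (G : LabeledGraph V E A) : Set (ℤ → E) :=
  {ξ | ∀ i : ℤ, G.term (ξ i) = G.init (ξ (i + 1))}

/-- All label sequences of bi-infinite paths. -/
def LabeledGraph.presented {V E A : Type*} (G : LabeledGraph V E A) : Set (ℤ → A) :=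
  (fun (ξ : ℤ → E) (i : ℤ) => G.label (ξ i)) '' G.edgeShift

/-- `X` is sofic: it is presented by a finite labeled graph. -/
def IsSofic {A : Type*} [TopologicalSpace A] (X : Subshift A ℤ) : Prop :=
  ∃ (V E : Type) (_ : Finite V) (_ : Finite E) (G : LabeledGraph V E A), X.carrier = G.presented

section Codes

variable {A B : Type*} [TopologicalSpace A] [TopologicalSpace B]
variable {X : Subshift A ℤ} {Y : Subshift B ℤ}

/-- `φ` is a (sliding block) code: for some `-m ≤ n` and some block map `Φ`,
`φ(x)_i = Φ(x_{[i-m, i+n]})`. Only the values of `Φ` at the blocks of `X` of length `m + n + 1`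
matter. -/
def IsCode (φ : X.carrier → Y.carrier) : Prop :=
  ∃ m n : ℤ, -m ≤ n ∧ ∃ Φ : List A → B,
    ∀ (x : X.carrier) (i : ℤ), (φ x : ℤ → B) i = Φ (block (x : ℤ → A) (i - m) (m + n + 1).toNat)

/-- Every point of `Y` has only finitely many preimages. -/
def IsFiniteToOne (φ : X.carrier → Y.carrier) : Prop :=
  ∀ y : Y.carrier, (φ ⁻¹' {y}).Finite

/-- The central `2l+1` cylinder of `X` around its point `x`: all points of `X` that agree with `x`
on `[-l, l]`. -/
def centralCylinder (X : Subshift A ℤ) (l : ℕ) (x : X.carrier) : Set X.carrier :=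
  {x' | (x' : ℤ → A) ∈ cylinder (Finset.Icc (-(l : ℤ)) (l : ℤ)) (x : ℤ → A)}

/-- `φ` is semi-open: for each `l` there is `k` such that the image of each central `2l+1` cylinder
in `X` contains a central `2k+1` cylinder in `Y`. -/
def IsSemiOpen (φ : X.carrier → Y.carrier) : Prop :=
  ∀ l : ℕ, ∃ k : ℕ, ∀ x : X.carrier, ∃ y : Y.carrier,
    centralCylinder Y k y ⊆ φ '' centralCylinder X l x

/-- `φ` is constant-to-one almost everywhere: for some positive integer `d`, every doubly
transitive point of `Y` has exactly `d` preimages. -/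
def IsConstantToOneAE (φ : X.carrier → Y.carrier) : Prop :=
  ∃ d : ℕ, 0 < d ∧ ∀ y : Y.carrier, IsDoublyTransitive Y (y : ℤ → B) →
    (φ ⁻¹' {y}).encard = (d : ℕ∞)

end Codes

end ShiftCode

namespace ShiftCode

/-! For each central block of `Y`, count the windows of radius `r` at `0` in the points of `X` lying
over it, and fix a block minimizing this count `d`. By minimality, prolonging the block loses no
window. So between two occurrences at distance `p`, the partial preimages show the same set `D` of
windows at both ends, and can be chained into preimages of a `p`-periodic point
(`exists_periodic_lift`). The finite fiber over such a point has a common period, which forces two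
of its members sharing a window to coincide (`eq_of_window_eq_of_periodic`). Hence one window at an
occurrence determines a preimage as far as any other occurrence (`eq_on_between`), and everywhere if
the block recurs in both directions. Compactness realizes every window of `D`, so the fiber has
exactly `d` points (`encard_fiber_eq`). Semi-openness enters through density of the image, which
gives `d > 0`. -/

/-! ### Windows, gluing and compactness -/

/-- The block of `x` on the interval `[t - r, t + r]`. -/
def window {A : Type*} (r : ℕ) (t : ℤ) (x : ℤ → A) : Set.Icc (-(r : ℤ)) r → A :=
  fun k => x (t + k)

theorem window_eq_iff {A : Type*} {r : ℕ} {t : ℤ} {x x' : ℤ → A} :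
    window r t x = window r t x' ↔ ∀ i, t - r ≤ i → i ≤ t + r → x i = x' i := by
  constructor
  · intro h i h₁ h₂
    have := congrFun h ⟨i - t, by omega, by omega⟩
    simpa [window] using this
  · intro h
    funext k
    have := k.2.1
    have := k.2.2
    exact h _ (by omega) (by omega)

theorem window_shift {A : Type*} (r : ℕ) (t g : ℤ) (x : ℤ → A) :
    window r t (shift g x) = window r (g + t) x := by
  funext k
  simp [window, add_assoc]

/-- The point that follows `x` up to time `t` and `x'` afterwards. -/
def glue {A : Type*} (t : ℤ) (x x' : ℤ → A) : ℤ → A :=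
  fun i => if i ≤ t then x i else x' i

/-- The switch at `t` goes unnoticed within the shared window, so agreement with `x` reaches `r`
steps past it. -/
theorem glue_eq_left {A : Type*} {r : ℕ} {t : ℤ} {x x' : ℤ → A}
    (h : window r t x = window r t x') {i : ℤ} (hi : i ≤ t + r) : glue t x x' i = x i := by
  rw [window_eq_iff] at h
  unfold glue
  split_ifs
  · rfl
  · exact (h i (by omega) hi).symm

theorem glue_eq_right {A : Type*} {r : ℕ} {t : ℤ} {x x' : ℤ → A}
    (h : window r t x = window r t x') {i : ℤ} (hi : t - r ≤ i) : glue t x x' i = x' i := by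
  rw [window_eq_iff] at h
  unfold glue
  split_ifs
  · exact h i hi (by omega)
  · rfl

/-- A finite-to-one sliding block map `ψ` of radius `r` on a closed shift-invariant set `S` in which
points with a common block of length `2r + 1` can be glued along it. -/
structure FiniteMemoryCode {A B : Type*} [TopologicalSpace A] (S : Set (ℤ → A))
    (ψ : (ℤ → A) → ℤ → B) (r : ℕ) : Prop where
  isClosed : IsClosed S
  shift_mem : ∀ (g : ℤ) (x), x ∈ S → shift g x ∈ S
  map_shift : ∀ (g : ℤ) (x), ψ (shift g x) = shift g (ψ x)
  local_rule : ∀ x x' j, window r j x = window r j x' → ψ x j = ψ x' j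
  glue_mem : ∀ x ∈ S, ∀ x' ∈ S, ∀ t, window r t x = window r t x' → glue t x x' ∈ S
  finite_fiber : ∀ y, {x | x ∈ S ∧ ψ x = y}.Finite

/-- A sequence in a closed set of configurations has a limit point in that set. -/
theorem exists_limit {A : Type*} [Finite A] [TopologicalSpace A] [DiscreteTopology A]
    {S : Set (ℤ → A)} (hS : IsClosed S) (u : ℕ → ℤ → A) (hu : ∀ n, u n ∈ S) :
    ∃ z ∈ S, ∀ M : ℕ, ∃ n, M ≤ n ∧ ∀ i : ℤ, -(M : ℤ) ≤ i → i ≤ M → u n i = z i := by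
  obtain ⟨z, hzS, hz⟩ := hS.isCompact.exists_mapClusterPt (f := Filter.atTop) (u := u)
    (Filter.tendsto_principal.2 (Filter.Eventually.of_forall hu))
  refine ⟨z, hzS, fun M => ?_⟩
  have hmem : cylinder (Finset.Icc (-(M : ℤ)) M) z ∈ nhds z :=
    (isOpen_cylinder _ z).mem_nhds fun _ _ => rfl
  obtain ⟨n, hn, h⟩ := Filter.frequently_atTop.1 (hz.frequently hmem) M
  exact ⟨n, hn, fun i h₁ h₂ => h i (Finset.mem_Icc.2 ⟨h₁, h₂⟩)⟩

/-! ### Fibers over periodic points -/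

namespace FiniteMemoryCode

variable {A B : Type*} [TopologicalSpace A] {S : Set (ℤ → A)} {ψ : (ℤ → A) → ℤ → B} {r : ℕ}

/-- The local rule at `j ≤ t` reads no coordinate beyond `t + r`. -/
theorem map_glue_left (hc : FiniteMemoryCode S ψ r) {t : ℤ} {x x' : ℤ → A}
    (h : window r t x = window r t x') {j : ℤ} (hj : j ≤ t) : ψ (glue t x x') j = ψ x j :=
  hc.local_rule _ _ _ (window_eq_iff.2 fun _ _ hi => glue_eq_left h (by omega))

theorem map_glue_right (hc : FiniteMemoryCode S ψ r) {t : ℤ} {x x' : ℤ → A}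
    (h : window r t x = window r t x') {j : ℤ} (hj : t ≤ j) : ψ (glue t x x') j = ψ x' j :=
  hc.local_rule _ _ _ (window_eq_iff.2 fun _ hi _ => glue_eq_right h (by omega))

/-- A point of `S` whose image agrees with `y` on all intervals in the limit. -/
theorem exists_lift_of_approx [Finite A] [DiscreteTopology A] (hc : FiniteMemoryCode S ψ r)
    (y : ℤ → B) (a : ℤ) (b : ℤ) (x : ℤ → A)
    (H : ∀ n : ℕ, ∃ z ∈ S, (∀ i, a ≤ i → i ≤ b → z i = x i) ∧
      ∀ i : ℤ, -(n : ℤ) ≤ i → i ≤ n → ψ z i = y i) :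
    ∃ z ∈ S, (∀ i, a ≤ i → i ≤ b → z i = x i) ∧ ψ z = y := by
  choose u huS hux huy using H
  obtain ⟨z, hzS, hz⟩ := exists_limit hc.isClosed u huS
  refine ⟨z, hzS, fun i h₁ h₂ => ?_, funext fun j => ?_⟩
  · obtain ⟨n, -, h⟩ := hz i.natAbs
    rw [← h i (by omega) (by omega), hux n i h₁ h₂]
  · obtain ⟨n, hn, h⟩ := hz (j.natAbs + r)
    rw [← huy n j (by omega) (by omega)]
    exact hc.local_rule _ _ _
      (window_eq_iff.2 fun i _ _ => (h i (by omega) (by omega)).symm)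

/-- Points of the fiber over a periodic point have a common period. -/
theorem exists_common_period (hc : FiniteMemoryCode S ψ r) {y : ℤ → B} {p : ℤ} (hp : 0 < p)
    (hy : shift p y = y) :
    ∃ q : ℤ, 0 < q ∧ ∀ x ∈ S, ψ x = y → ∀ i, x (i + q) = x i := by
  let Z := {x | x ∈ S ∧ ψ x = y}
  have : Finite Z := hc.finite_fiber y
  -- The shift by `p` permutes the finite fiber; its order times `p` is the common period.
  let f : Z → Z := fun x => ⟨shift p x.1, hc.shift_mem _ _ x.2.1, by
    rw [hc.map_shift, x.2.2, hy]⟩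
  have hf : Function.Injective f := by
    intro x x' h
    have h' : shift p x.1 = shift p x'.1 := congrArg Subtype.val h
    refine Subtype.ext (funext fun i => ?_)
    simpa using congrFun h' (i - p)
  let e : Equiv.Perm Z := Equiv.ofBijective f (Finite.injective_iff_bijective.1 hf)
  have he : ∀ (n : ℕ) (x : Z) (i : ℤ), ((e ^ n) x).1 i = x.1 (i + n * p) := by
    intro n
    induction n with
    | zero => simp
    | succ k ih =>
      intro x i
      rw [pow_succ, Equiv.Perm.mul_apply, ih]
      exact congrArg x.1 (by push_cast; ring)
  refine ⟨orderOf e * p, mul_pos (by exact_mod_cast orderOf_pos e) hp, fun x hx hxy i => ?_⟩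
  have := he (orderOf e) ⟨x, hx, hxy⟩ i
  rw [pow_orderOf_eq_one] at this
  exact this.symm

/-- Two points over a periodic point with a common block of length `2r + 1` are equal. -/
theorem eq_of_window_eq_of_periodic (hc : FiniteMemoryCode S ψ r) {y : ℤ → B} {p : ℤ} (hp : 0 < p)
    (hy : shift p y = y) {z z' : ℤ → A} (hz : z ∈ S) (hz' : z' ∈ S) (hzy : ψ z = y)
    (hzy' : ψ z' = y) {t : ℤ} (h : window r t z = window r t z') : z = z' := by
  obtain ⟨q, hq, hper⟩ := hc.exists_common_period hp hy
  -- The gluing lies in the same fiber, hence has period `q`. It equals `z` far to the left and `z'`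
  -- far to the right, so it equals both.
  have hg : ψ (glue t z z') = y := by
    funext j
    rcases le_total j t with hj | hj
    · rw [hc.map_glue_left h hj, hzy]
    · rw [hc.map_glue_right h hj, hzy']
  have hgS := hc.glue_mem z hz z' hz' t h
  have periodic : ∀ x ∈ S, ψ x = y → ∀ (n : ℕ) (i : ℤ), x (i + n * q) = x i := by
    intro x hx hxy n
    induction n with
    | zero => simp
    | succ k ih =>
      intro i
      rw [← ih i, ← hper x hx hxy (i + k * q)]
      congr 1
      push_cast
      ring
  funext i
  have hle : (0 : ℤ) ≤ ((i - t).natAbs : ℤ) := by positivity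
  have hbig : ((i - t).natAbs : ℤ) ≤ (i - t).natAbs * q := le_mul_of_one_le_right hle hq
  have h₁ : glue t z z' (i - (i - t).natAbs * q) = z (i - (i - t).natAbs * q) :=
    glue_eq_left h (by omega)
  have h₂ : glue t z z' (i + (i - t).natAbs * q) = z' (i + (i - t).natAbs * q) :=
    glue_eq_right h (by omega)
  have h₃ := periodic _ hgS hg (i - t).natAbs (i - (i - t).natAbs * q)
  have h₄ := periodic _ hz hzy (i - t).natAbs (i - (i - t).natAbs * q)
  rw [sub_add_cancel] at h₃ h₄
  rw [h₄, ← h₁, ← h₃, ← periodic _ hgS hg (i - t).natAbs i, h₂, periodic _ hz' hzy']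

/-! ### Chaining partial preimages over a repeated block -/

section Transition

variable {E : Set (ℤ → A)} {D : Set (Set.Icc (-(r : ℤ)) r → A)} {p : ℤ} {v : ℤ → B}

/-- If the points of `E` lie over `v` on `[0, p]` and their blocks around `0` and around `p` both
run through `D`, then each of them can be followed over an arbitrarily long stretch of the
`p`-periodic point that repeats `v_{[0, p-1]}`. -/
theorem exists_periodic_stretch (hc : FiniteMemoryCode S ψ r) (hp : 0 < p) (hES : E ⊆ S)
    (hv : v 0 = v p) (hEv : ∀ e ∈ E, ∀ i, 0 ≤ i → i ≤ p → ψ e i = v i)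
    (hD₀ : window r 0 '' E = D) (hDp : window r p '' E = D) {x : ℤ → A} (hx : x ∈ E) (n : ℕ) :
    ∃ z ∈ S, (∀ i, -(r : ℤ) ≤ i → i ≤ p + r → z i = x i) ∧
      (∀ i, -(n * p) ≤ i → i ≤ (n + 1) * p → ψ z i = v (i % p)) ∧
      window r (-(n * p)) z ∈ D ∧ window r ((n + 1) * p) z ∈ D := by
  -- A translate of `e` covers the `k`-th period; `v 0 = v p` takes care of the right endpoint.
  have hmod : ∀ e ∈ E, ∀ (k i : ℤ), k * p ≤ i → i ≤ (k + 1) * p →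
      ψ (shift (-(k * p)) e) i = v (i % p) := by
    intro e he k i h₁ h₂
    rw [hc.map_shift, shift_apply, hEv e he _ (by linarith) (by linarith)]
    rcases h₂.lt_or_eq with h₂ | rfl
    · congr 1
      rw [← Int.emod_eq_of_lt (a := -(k * p) + i) (b := p) (by linarith) (by linarith)]
      simp [← neg_mul]
    · rw [Int.mul_emod_left, hv]
      congr 1
      ring
  induction n with
  | zero =>
    refine ⟨x, hES hx, fun _ _ _ => rfl, fun i h₁ h₂ => ?_, ?_, ?_⟩
    · simpa using hmod x hx 0 i (by simpa using h₁) (by simpa using h₂)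
    · rw [← hD₀]
      exact ⟨x, hx, by simp⟩
    · rw [← hDp]
      exact ⟨x, hx, by simp⟩
  | succ n ih =>
    obtain ⟨z, hzS, hzx, hzv, hl, hr⟩ := ih
    have hn : (0 : ℤ) ≤ n * p := by positivity
    -- The window at the right end starts some `e ∈ E` and the one at the left end finishes some `e'
    -- ∈ E`; translates of these are glued on.
    rw [← hD₀] at hr
    rw [← hDp] at hl
    obtain ⟨e, he, hez⟩ := hr
    obtain ⟨e', he', hez'⟩ := hl
    have hR : window r ((n + 1) * p) z = window r ((n + 1) * p) (shift (-((n + 1) * p)) e) := by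
      rw [window_shift, ← hez]
      simp
    have hL : window r (-(n * p)) (shift (-((-(n + 1)) * p)) e') =
        window r (-(n * p)) (glue ((n + 1) * p) z (shift (-((n + 1) * p)) e)) := by
      rw [window_shift]
      have h₁ : -((-(n + 1)) * p) + -(n * p) = p := by ring
      rw [h₁, hez', window_eq_iff]
      intro i _ h₂
      exact (glue_eq_left hR (by linarith)).symm
    have hz₁S := hc.glue_mem z hzS _ (hc.shift_mem (-((n + 1) * p)) e (hES he)) _ hR
    refine ⟨_, hc.glue_mem _ (hc.shift_mem (-((-(n + 1)) * p)) e' (hES he')) _ hz₁S _ hL,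
      fun i h₁ h₂ => ?_, fun i h₁ h₂ => ?_, ?_, ?_⟩
    · rw [glue_eq_right hL (by linarith), glue_eq_left hR (by linarith), hzx i h₁ h₂]
    · push_cast at h₁ h₂
      rcases le_total i (-(n * p)) with hi | hi
      · rw [hc.map_glue_left hL hi]
        exact hmod e' he' _ i (by linarith) (by linarith)
      · rw [hc.map_glue_right hL hi]
        rcases le_total i ((n + 1) * p) with hi' | hi'
        · rw [hc.map_glue_left hR hi', hzv i hi hi']
        · rw [hc.map_glue_right hR hi']
          exact hmod e he _ i hi' h₂
    · rw [← hD₀]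
      refine ⟨e', he', ?_⟩
      have : window r (-((n + 1 : ℕ) * p)) (shift (-((-(n + 1)) * p)) e') = window r 0 e' := by
        rw [window_shift]
        congr 1
        push_cast
        ring
      rw [← this, window_eq_iff]
      intro i _ h₂
      push_cast at h₂
      exact (glue_eq_left hL (by linarith)).symm
    · rw [← hDp]
      refine ⟨e, he, ?_⟩
      have : window r (((n + 1 : ℕ) + 1) * p) (shift (-((n + 1) * p)) e) = window r p e := by
        rw [window_shift]
        congr 1
        push_cast
        ring
      rw [← this, window_eq_iff]
      intro i h₁ _
      push_cast at h₁
      rw [glue_eq_right hL (by linarith), glue_eq_right hR (by linarith)]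

/-- In the situation of `exists_periodic_stretch`, every point of `E` can be followed over the whole
periodic point. -/
theorem exists_periodic_lift [Finite A] [DiscreteTopology A] (hc : FiniteMemoryCode S ψ r)
    (hp : 0 < p) (hES : E ⊆ S)
    (hv : v 0 = v p) (hEv : ∀ e ∈ E, ∀ i, 0 ≤ i → i ≤ p → ψ e i = v i)
    (hD₀ : window r 0 '' E = D) (hDp : window r p '' E = D) {x : ℤ → A} (hx : x ∈ E) :
    ∃ z ∈ S, (∀ i, -(r : ℤ) ≤ i → i ≤ p + r → z i = x i) ∧ ψ z = fun i => v (i % p) := by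
  refine hc.exists_lift_of_approx _ _ _ _ fun n => ?_
  obtain ⟨z, hzS, hzx, hzv, -, -⟩ := hc.exists_periodic_stretch hp hES hv hEv hD₀ hDp hx n
  have hn : (n : ℤ) ≤ n * p := le_mul_of_one_le_right (by positivity) hp
  exact ⟨z, hzS, hzx, fun i h₁ h₂ => hzv i (by linarith) (by linarith)⟩

/-- In the situation of `exists_periodic_stretch`, a point of `E` is determined on
`[-r, p + r]` by any of its blocks around a time `t ∈ [0, p]`. -/
theorem eq_on_of_window_eq [Finite A] [DiscreteTopology A] (hc : FiniteMemoryCode S ψ r)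
    (hp : 0 < p) (hES : E ⊆ S)
    (hv : v 0 = v p) (hEv : ∀ e ∈ E, ∀ i, 0 ≤ i → i ≤ p → ψ e i = v i)
    (hD₀ : window r 0 '' E = D) (hDp : window r p '' E = D) {x x' : ℤ → A} (hx : x ∈ E)
    (hx' : x' ∈ E) {t : ℤ} (ht₀ : 0 ≤ t) (htp : t ≤ p) (h : window r t x = window r t x') {i : ℤ}
    (hi₀ : -(r : ℤ) ≤ i) (hip : i ≤ p + r) : x i = x' i := by
  obtain ⟨z, hzS, hzx, hzv⟩ := hc.exists_periodic_lift hp hES hv hEv hD₀ hDp hx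
  obtain ⟨z', hzS', hzx', hzv'⟩ := hc.exists_periodic_lift hp hES hv hEv hD₀ hDp hx'
  have : z = z' := by
    refine hc.eq_of_window_eq_of_periodic hp ?_ hzS hzS' hzv hzv' (t := t) ?_
    · funext i
      simp
    · rw [window_eq_iff] at h ⊢
      intro i h₁ h₂
      rw [hzx i (by omega) (by omega), hzx' i (by omega) (by omega), h i h₁ h₂]
  rw [← hzx i hi₀ hip, ← hzx' i hi₀ hip, this]

end Transition

end FiniteMemoryCode

/-! ### Blocks of minimal degree -/

/-- The blocks on `[-r, r]` of the points of `S` whose image agrees with `y` on `[-N, N]`. -/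
def fiberWindows {A B : Type*} (S : Set (ℤ → A)) (ψ : (ℤ → A) → ℤ → B) (r : ℕ) (y : ℤ → B)
    (N : ℕ) : Set (Set.Icc (-(r : ℤ)) r → A) :=
  window r 0 '' {x | x ∈ S ∧ ∀ i : ℤ, -(N : ℤ) ≤ i → i ≤ N → ψ x i = y i}

theorem fiberWindows_subset {A B : Type*} {S : Set (ℤ → A)} {ψ : (ℤ → A) → ℤ → B} {r : ℕ}
    {y y₀ : ℤ → B} {N N₀ : ℕ} (hN : N₀ ≤ N) (h : ∀ i : ℤ, -(N₀ : ℤ) ≤ i → i ≤ N₀ → y i = y₀ i) :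
    fiberWindows S ψ r y N ⊆ fiberWindows S ψ r y₀ N₀ := by
  rintro _ ⟨x, ⟨hxS, hx⟩, rfl⟩
  exact ⟨x, ⟨hxS, fun i h₁ h₂ => by rw [hx i (by omega) (by omega), h i h₁ h₂]⟩, rfl⟩

/-- A block of minimal degree: all occurrences of `y₀_{[-N₀, N₀]}` have the same fiber windows. -/
theorem fiberWindows_eq {A B : Type*} [Finite A] {S : Set (ℤ → A)} {ψ : (ℤ → A) → ℤ → B} {r : ℕ}
    {Y : Set (ℤ → B)} {y₀ : ℤ → B} {N₀ : ℕ}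
    (hmin : ∀ y ∈ Y, ∀ N, (fiberWindows S ψ r y₀ N₀).ncard ≤ (fiberWindows S ψ r y N).ncard)
    {y : ℤ → B} (hy : y ∈ Y) (h : ∀ i : ℤ, -(N₀ : ℤ) ≤ i → i ≤ N₀ → y i = y₀ i)
    {N : ℕ} (hN : N₀ ≤ N) : fiberWindows S ψ r y N = fiberWindows S ψ r y₀ N₀ :=
  Set.eq_of_subset_of_ncard_le (fiberWindows_subset hN h) (hmin y hy N) (Set.toFinite _)

namespace FiniteMemoryCode

variable {A B : Type*} [Finite A] [TopologicalSpace A] [DiscreteTopology A] {S : Set (ℤ → A)}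
  {ψ : (ℤ → A) → ℤ → B} {r : ℕ} {Y : Set (ℤ → B)} {y₀ : ℤ → B} {N₀ : ℕ}

/-- Between two occurrences of a block of minimal degree, a preimage is determined by its block
around either of them. -/
theorem eq_on_between (hc : FiniteMemoryCode S ψ r) (hY : ∀ (g : ℤ), ∀ y ∈ Y, shift g y ∈ Y)
    (hmin : ∀ y ∈ Y, ∀ N, (fiberWindows S ψ r y₀ N₀).ncard ≤ (fiberWindows S ψ r y N).ncard)
    {y : ℤ → B} (hy : y ∈ Y) {s t : ℤ} (hst : s < t)
    (hs : ∀ i : ℤ, -(N₀ : ℤ) ≤ i → i ≤ N₀ → y (s + i) = y₀ i)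
    (ht : ∀ i : ℤ, -(N₀ : ℤ) ≤ i → i ≤ N₀ → y (t + i) = y₀ i)
    {x x' : ℤ → A} (hx : x ∈ S) (hx' : x' ∈ S) (hxy : ψ x = y) (hxy' : ψ x' = y)
    {m : ℤ} (hm : m = s ∨ m = t) (h : window r m x = window r m x') {i : ℤ}
    (hi₁ : s - r ≤ i) (hi₂ : i ≤ t + r) : x i = x' i := by
  set p := t - s with hp
  set v := shift s y with hv
  set E := {x | x ∈ S ∧ ∀ i : ℤ, -(N₀ : ℤ) ≤ i → i ≤ p + N₀ → ψ x i = v i} with hE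
  have hvY : v ∈ Y := hY s y hy
  have hwY : shift p v ∈ Y := hY p v hvY
  have hv₀ : ∀ i : ℤ, -(N₀ : ℤ) ≤ i → i ≤ N₀ → v i = y₀ i := hs
  have hw₀ : ∀ i : ℤ, -(N₀ : ℤ) ≤ i → i ≤ N₀ → shift p v i = y₀ i := by
    intro i h₁ h₂
    rw [← ht i h₁ h₂]
    simp only [hv, hp, shift_apply]
    congr 1
    ring
  -- Around `0` as around `p`, the interval of radius `N₀ + p` covers `[-N₀, p + N₀]`, so the
  -- windows of `E` lie between two sets that minimality makes equal.
  have hle : N₀ ≤ N₀ + p.toNat := Nat.le_add_right _ _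
  have hD₀ : window r 0 '' E = fiberWindows S ψ r y₀ N₀ := by
    apply Set.Subset.antisymm
    · rintro _ ⟨e, ⟨heS, he⟩, rfl⟩
      exact ⟨e, ⟨heS, fun i h₁ h₂ => by rw [he i h₁ (by omega), hv₀ i h₁ h₂]⟩, rfl⟩
    · rw [← fiberWindows_eq hmin hvY hv₀ hle]
      rintro _ ⟨e, ⟨heS, he⟩, rfl⟩
      exact ⟨e, ⟨heS, fun i h₁ h₂ => he i (by omega) (by omega)⟩, rfl⟩
  have hDp : window r p '' E = fiberWindows S ψ r y₀ N₀ := by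
    apply Set.Subset.antisymm
    · rintro _ ⟨e, ⟨heS, he⟩, rfl⟩
      refine ⟨shift p e, ⟨hc.shift_mem p e heS, fun i h₁ h₂ => ?_⟩, by simp [window_shift]⟩
      rw [hc.map_shift, shift_apply, he _ (by omega) (by omega), ← hw₀ i h₁ h₂, shift_apply]
    · rw [← fiberWindows_eq hmin hwY hw₀ hle]
      rintro _ ⟨e, ⟨heS, he⟩, rfl⟩
      refine ⟨shift (-p) e, ⟨hc.shift_mem _ e heS, fun i h₁ h₂ => ?_⟩, by simp [window_shift]⟩
      rw [hc.map_shift, shift_apply, he _ (by omega) (by omega), shift_apply]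
      simp
  have hmem : ∀ x ∈ S, ψ x = y → shift s x ∈ E := fun x hx hxy =>
    ⟨hc.shift_mem s x hx, fun i _ _ => by rw [hc.map_shift, hxy]⟩
  have key := hc.eq_on_of_window_eq (t := m - s) (i := i - s) (by omega)
    (fun e (he : e ∈ E) => he.1)
    (by rw [hv₀ 0 (by omega) (by omega), ← hw₀ 0 (by omega) (by omega), shift_apply, add_zero])
    (fun e he i h₁ h₂ => he.2 i (by omega) (by omega)) hD₀ hDp (hmem x hx hxy) (hmem x' hx' hxy')
    (by omega) (by omega) (by simpa [window_shift] using h) (by omega) (by omega)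
  simpa using key

/-- A point in which a block of minimal degree recurs in both directions has as many preimages as
this block has fiber windows. -/
theorem encard_fiber_eq (hc : FiniteMemoryCode S ψ r) (hY : ∀ (g : ℤ), ∀ y ∈ Y, shift g y ∈ Y)
    (hmin : ∀ y ∈ Y, ∀ N, (fiberWindows S ψ r y₀ N₀).ncard ≤ (fiberWindows S ψ r y N).ncard)
    {y : ℤ → B} (hy : y ∈ Y)
    (hleft : ∀ n : ℤ, ∃ t ≤ n, ∀ i : ℤ, -(N₀ : ℤ) ≤ i → i ≤ N₀ → y (t + i) = y₀ i)
    (hright : ∀ n : ℤ, ∃ t ≥ n, ∀ i : ℤ, -(N₀ : ℤ) ≤ i → i ≤ N₀ → y (t + i) = y₀ i) :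
    {x | x ∈ S ∧ ψ x = y}.encard = ((fiberWindows S ψ r y₀ N₀).ncard : ℕ∞) := by
  obtain ⟨t, -, ht⟩ := hright 0
  have hinj : Set.InjOn (window r t) {x | x ∈ S ∧ ψ x = y} := by
    rintro x ⟨hx, hxy⟩ x' ⟨hx', hxy'⟩ h
    funext i
    rcases le_total i t with hi | hi
    -- The bound `t - 1` makes the two occurrences distinct.
    · obtain ⟨s, hs, hs'⟩ := hleft (min i (t - 1))
      exact hc.eq_on_between hY hmin hy (by omega) hs' ht hx hx' hxy hxy' (Or.inr rfl) h
        (by omega) (by omega)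
    · obtain ⟨s, hs, hs'⟩ := hright (max i (t + 1))
      exact hc.eq_on_between hY hmin hy (by omega) ht hs' hx hx' hxy hxy' (Or.inl rfl) h
        (by omega) (by omega)
  have himage : window r t '' {x | x ∈ S ∧ ψ x = y} = fiberWindows S ψ r y₀ N₀ := by
    apply Set.Subset.antisymm
    · rintro _ ⟨x, ⟨hx, hxy⟩, rfl⟩
      refine ⟨shift t x, ⟨hc.shift_mem t x hx, fun i h₁ h₂ => ?_⟩, by simp [window_shift]⟩
      rw [hc.map_shift, hxy, shift_apply, ht i h₁ h₂]
    · rintro _ ⟨x, ⟨hx, hxy⟩, rfl⟩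
      obtain ⟨z, hzS, hzx, hzy⟩ := hc.exists_lift_of_approx (shift t y) (-r) r x fun n => by
        have h : window r 0 x ∈ fiberWindows S ψ r (shift t y) (max n N₀) := by
          rw [fiberWindows_eq hmin (hY t y hy) ht (le_max_right _ _)]
          exact ⟨x, ⟨hx, hxy⟩, rfl⟩
        obtain ⟨z, ⟨hzS, hzy⟩, hzx⟩ := h
        rw [window_eq_iff] at hzx
        exact ⟨z, hzS, fun i h₁ h₂ => hzx i (by omega) (by omega),
          fun i h₁ h₂ => hzy i (by omega) (by omega)⟩
      refine ⟨shift (-t) z, ⟨hc.shift_mem _ z hzS, ?_⟩, ?_⟩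
      · rw [hc.map_shift, hzy]
        funext i
        simp
      · rw [window_shift, neg_add_cancel, window_eq_iff]
        exact fun i h₁ h₂ => hzx i (by omega) (by omega)
  rw [← hinj.encard_image, himage, (Set.toFinite _).cast_ncard_eq]

/-- Points of `Y` in which every block of `Y` recurs in both directions all have the same number of
preimages, provided that `S` maps to a dense subset of `Y`. -/
theorem exists_degree (hc : FiniteMemoryCode S ψ r) (hY : ∀ (g : ℤ), ∀ y ∈ Y, shift g y ∈ Y)
    (hne : Y.Nonempty)
    (hdense : ∀ y ∈ Y, ∀ N : ℕ, ∃ x ∈ S, ∀ i : ℤ, -(N : ℤ) ≤ i → i ≤ N → ψ x i = y i) :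
    ∃ d : ℕ, 0 < d ∧ ∀ y ∈ Y,
      (∀ u ∈ Y, ∀ N : ℕ, ∀ n : ℤ,
        (∃ t ≤ n, ∀ i : ℤ, -(N : ℤ) ≤ i → i ≤ N → y (t + i) = u i) ∧
        ∃ t ≥ n, ∀ i : ℤ, -(N : ℤ) ≤ i → i ≤ N → y (t + i) = u i) →
      {x | x ∈ S ∧ ψ x = y}.encard = (d : ℕ∞) := by
  obtain ⟨y₁, hy₁⟩ := hne
  obtain ⟨⟨⟨y₀, hy₀⟩, N₀⟩, -, hmin⟩ :=
    (measure fun q : Y × ℕ => (fiberWindows S ψ r q.1 q.2).ncard).wf.has_min Set.univ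
      ⟨(⟨y₁, hy₁⟩, 0), trivial⟩
  refine ⟨(fiberWindows S ψ r y₀ N₀).ncard, ?_, fun y hy h => ?_⟩
  · rw [Set.ncard_pos]
    obtain ⟨x, hx, hxy⟩ := hdense y₀ hy₀ N₀
    exact ⟨_, x, ⟨hx, hxy⟩, rfl⟩
  · exact hc.encard_fiber_eq hY
      (fun y hy N => not_lt.1 (hmin (⟨y, hy⟩, N) trivial)) hy
      (fun n => (h y₀ hy₀ N₀ n).1) (fun n => (h y₀ hy₀ N₀ n).2)

end FiniteMemoryCode

/-! ### From words, shifts of finite type and codes to windows -/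

theorem block_eq_iff {A : Type*} {x x' : ℤ → A} {i i' : ℤ} {n : ℕ} :
    block x i n = block x' i' n ↔ ∀ k : ℤ, 0 ≤ k → k < n → x (i + k) = x' (i' + k) := by
  unfold block
  rw [List.ofFn_inj, funext_iff]
  constructor
  · intro h k h₁ h₂
    simpa [Int.toNat_of_nonneg h₁] using h ⟨k.toNat, by omega⟩
  · exact fun h k => h _ (by omega) (by omega)

@[simp]
theorem length_block {A : Type*} (x : ℤ → A) (i : ℤ) (n : ℕ) : (block x i n).length = n := by
  simp [block]

theorem block_shift {A : Type*} (g : ℤ) (x : ℤ → A) (i : ℤ) (n : ℕ) :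
    block (shift g x) i n = block x (g + i) n := by
  rw [block_eq_iff]
  simp [add_assoc]

theorem occursAt_block_iff {A : Type*} {x y : ℤ → A} {i j : ℤ} {n : ℕ} :
    OccursAt (block y i n) x j ↔ ∀ k : ℤ, 0 ≤ k → k < n → x (j + k) = y (i + k) := by
  rw [OccursAt, length_block, block_eq_iff]

theorem block_mem_language {A : Type*} [TopologicalSpace A] {Y : Subshift A ℤ} {y : ℤ → A}
    (hy : y ∈ Y.carrier) (i : ℤ) (n : ℕ) : block y i n ∈ language Y :=
  ⟨y, hy, i, by rw [OccursAt, length_block]⟩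

/-- The two ends of an occurrence of `u ++ w ++ v`. -/
theorem OccursAt.ends {A : Type*} {u w v : List A} {x : ℤ → A} {i : ℤ}
    (h : OccursAt (u ++ w ++ v) x i) :
    OccursAt u x i ∧ OccursAt v x (i + u.length + w.length) := by
  have hget : ∀ k (hk : k < (u ++ w ++ v).length), x (i + k) = (u ++ w ++ v)[k] := by
    intro k hk
    conv_rhs => rw [List.getElem_of_eq h.symm hk]
    simp [block]
  constructor
  · refine List.ext_getElem (by simp) fun k hk hk' => ?_
    have := hget k (by simp; omega)
    rw [List.getElem_append_left (by simp; omega), List.getElem_append_left hk'] at this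
    simpa [block] using this
  · refine List.ext_getElem (by simp) fun k hk hk' => ?_
    have := hget (u.length + w.length + k) (by simp; omega)
    rw [List.getElem_append_right (by simp)] at this
    simp only [List.length_append, add_tsub_cancel_left] at this
    simpa [block, add_assoc] using this

section Codes

variable {A B : Type*} [TopologicalSpace A] [TopologicalSpace B]
variable {X : Subshift A ℤ} {Y : Subshift B ℤ}

/-- Points of a shift of finite type can be glued along a common sufficiently long block. -/
theorem IsSFT.exists_glue_mem (hX : IsSFT X) :
    ∃ L : ℕ, ∀ r ≥ L, ∀ x ∈ X.carrier, ∀ x' ∈ X.carrier, ∀ t,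
      window r t x = window r t x' → glue t x x' ∈ X.carrier := by
  obtain ⟨F, hF⟩ := hX
  refine ⟨F.sup List.length, fun r hr x hx x' hx' t h => ?_⟩
  rw [hF] at hx hx' ⊢
  intro w hw i hocc
  have hlen : w.length ≤ r := (Finset.le_sup (f := List.length) hw).trans hr
  -- A word of length at most `r` starting by time `t` ends before `t + r`, so it already occurs in
  -- `x`; one starting later occurs in `x'`.
  rcases le_total i t with hi | hi
  · refine hx w hw i (Eq.trans (block_eq_iff.2 fun k h₁ h₂ => ?_) hocc)
    exact (glue_eq_left h (by omega)).symm
  · refine hx' w hw i (Eq.trans (block_eq_iff.2 fun k h₁ h₂ => ?_) hocc)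
    exact (glue_eq_right h (by omega)).symm

/-- A semi-open code into an irreducible shift has dense image. -/
theorem IsSemiOpen.exists_image_eq_on (hYirr : IsIrreducible Y) (hXne : X.carrier.Nonempty)
    {φ : X.carrier → Y.carrier} (hopen : IsSemiOpen φ)
    {ψ : (ℤ → A) → ℤ → B} (hψ : ∀ x : X.carrier, (φ x : ℤ → B) = ψ x)
    (hshift : ∀ (g : ℤ) (x : ℤ → A), ψ (shift g x) = shift g (ψ x))
    {y : ℤ → B} (hy : y ∈ Y.carrier) (N : ℕ) :
    ∃ x ∈ X.carrier, ∀ i : ℤ, -(N : ℤ) ≤ i → i ≤ N → ψ x i = y i := by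
  obtain ⟨x₀, hx₀⟩ := hXne
  -- Any `l` would do: a single cylinder inside the image suffices, since irreducibility joins the
  -- block of `y` to it.
  obtain ⟨k, hk⟩ := hopen 0
  obtain ⟨⟨y₀, hy₀⟩, hcyl⟩ := hk ⟨x₀, hx₀⟩
  obtain ⟨w, y', hy', j, hocc⟩ := hYirr _ (block_mem_language hy (-N) (2 * N + 1))
    _ (block_mem_language hy₀ (-k) (2 * k + 1))
  obtain ⟨hu, hv⟩ := hocc.ends
  rw [length_block] at hv
  rw [occursAt_block_iff] at hu hv
  -- The centre of the occurrence of the block of `y₀`; that of `y` is centred at `j + N`.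
  set c : ℤ := j + (2 * N + 1 : ℕ) + w.length + k
  obtain ⟨x, -, hx⟩ := @hcyl ⟨shift c y', Y.mapsTo c hy'⟩ fun i hi => by
    rw [Finset.mem_Icc] at hi
    have := hv (i + k) (by omega) (by omega)
    rw [neg_add_cancel_comm_assoc] at this
    refine Eq.trans (congrArg y' ?_) this
    change c + i = _
    omega
  have hxψ : ψ x = shift c y' := by rw [← hψ, hx]
  refine ⟨shift (j + N - c) x, X.mapsTo _ x.2, fun i h₁ h₂ => ?_⟩
  have := hu (i + N) (by omega) (by omega)
  rw [neg_add_cancel_comm_assoc] at this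
  rw [hshift, hxψ, ← this]
  simp only [shift_apply]
  congr 1
  omega

/-- A finite-to-one code on a shift of finite type extends to a block map on the full shift which
is a `FiniteMemoryCode`. -/
theorem IsCode.exists_finiteMemoryCode (hX : IsSFT X) {φ : X.carrier → Y.carrier} (hφ : IsCode φ)
    (hfin : IsFiniteToOne φ) :
    ∃ (ψ : (ℤ → A) → ℤ → B) (r : ℕ), FiniteMemoryCode X.carrier ψ r ∧
      ∀ x : X.carrier, (φ x : ℤ → B) = ψ x := by
  obtain ⟨m, n, hmn, Φ, hΦ⟩ := hφ
  obtain ⟨L, hL⟩ := hX.exists_glue_mem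
  let ψ : (ℤ → A) → ℤ → B := fun x j => Φ (block x (j - m) (m + n + 1).toNat)
  have hψ : ∀ x : X.carrier, (φ x : ℤ → B) = ψ x := fun x => funext fun j => hΦ x j
  -- `L` allows gluing, and `|m| + |n|` makes the window contain the coding interval.
  refine ⟨ψ, L + m.natAbs + n.natAbs, ⟨X.isClosed, fun g x hx => X.mapsTo g hx, fun g x => ?_,
    fun x x' j h => ?_, hL _ (by omega), fun y => ?_⟩, hψ⟩
  · funext j
    simp [ψ, block_shift, add_sub_assoc]
  · refine congrArg Φ (block_eq_iff.2 fun k h₁ h₂ => ?_)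
    exact window_eq_iff.1 h _ (by omega) (by omega)
  · by_cases hy : y ∈ Y.carrier
    · refine ((hfin ⟨y, hy⟩).image Subtype.val).subset ?_
      rintro x ⟨hx, hxy⟩
      exact ⟨⟨x, hx⟩, Subtype.ext ((hψ ⟨x, hx⟩).trans hxy), rfl⟩
    · convert Set.finite_empty
      refine Set.eq_empty_of_forall_notMem ?_
      rintro x ⟨hx, rfl⟩
      exact hy (hψ ⟨x, hx⟩ ▸ (φ ⟨x, hx⟩).2)

/-- Every central block of `Y` recurs in both directions in a doubly transitive point. -/
theorem IsDoublyTransitive.recurs {y : ℤ → B} (hy : IsDoublyTransitive Y y) {u : ℤ → B}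
    (hu : u ∈ Y.carrier) (N : ℕ) (n : ℤ) :
    (∃ t ≤ n, ∀ i : ℤ, -(N : ℤ) ≤ i → i ≤ N → y (t + i) = u i) ∧
      ∃ t ≥ n, ∀ i : ℤ, -(N : ℤ) ≤ i → i ≤ N → y (t + i) = u i := by
  have hcentral : ∀ j : ℤ, OccursAt (block u (-N) (2 * N + 1)) y j →
      ∀ i : ℤ, -(N : ℤ) ≤ i → i ≤ N → y (j + N + i) = u i := by
    intro j hj i h₁ h₂
    rw [occursAt_block_iff] at hj
    have := hj (i + N) (by omega) (by omega)
    rw [neg_add_cancel_comm_assoc] at this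
    rw [← this]
    congr 1
    omega
  -- The extra `N` keeps the centre `j + N`, not just the start `j`, to the left of `n`.
  obtain ⟨⟨j, hj, hjo⟩, j', hj', hjo'⟩ :=
    hy.2 _ (block_mem_language hu (-N) (2 * N + 1)) (n.natAbs + N)
  exact ⟨⟨j + N, by omega, hcentral j hjo⟩, j' + N, by omega, hcentral j' hjo'⟩

end Codes

end ShiftCode

theorem theorem4p5 {A B : Type*}
    [Finite A] [TopologicalSpace A] [DiscreteTopology A]
    [Finite B] [TopologicalSpace B] [DiscreteTopology B]
    (X : Subshift A ℤ) (Y : Subshift B ℤ)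
    (hXne : X.carrier.Nonempty) (hX : ShiftCode.IsSFT X)
    (hYsofic : ShiftCode.IsSofic Y) (hYirr : ShiftCode.IsIrreducible Y)
    (φ : X.carrier → Y.carrier) (hφ : ShiftCode.IsCode φ)
    (hfin : ShiftCode.IsFiniteToOne φ) (hopen : ShiftCode.IsSemiOpen φ) :
    ShiftCode.IsConstantToOneAE φ := by
  obtain ⟨ψ, r, hc, hψ⟩ := hφ.exists_finiteMemoryCode hX hfin
  obtain ⟨x₀, hx₀⟩ := hXne
  obtain ⟨d, hd, H⟩ := hc.exists_degree (fun g y hy => Y.mapsTo g hy) ⟨_, (φ ⟨x₀, hx₀⟩).2⟩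
    fun y hy N => hopen.exists_image_eq_on hYirr ⟨x₀, hx₀⟩ hψ hc.map_shift hy N
  refine ⟨d, hd, fun y hy => ?_⟩
  rw [← H y y.2 fun u hu N n => hy.recurs hu N n,
    ← (Subtype.val_injective.injOn (s := φ ⁻¹' {y})).encard_image]
  congr 1
  ext x
  constructor
  · rintro ⟨x, rfl, rfl⟩
    exact ⟨x.2, (hψ x).symm⟩
  · rintro ⟨hx, hxy⟩
    exact ⟨⟨x, hx⟩, Subtype.ext ((hψ ⟨x, hx⟩).trans hxy), rfl⟩
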